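/- Let $d$ be a fixed positive integer. A $d$-dimensional Fano polyhedron is a convex polytope $P\subset\mathbb{R}^d$ (the convex hull of finitely many points) such that: (i) all vertices of $P$ belong to the lattice $\mathbb{Z}^d$; (ii) the origin lies in the interior of $P$; (iii) $P$ is simplicial, i.e. every proper face of $P$ is a simplex; (iv) the vertices of every $(d-1)$-dimensional face of $P$ form a $\mathbb{Z}$-basis of $\mathbb{Z}^d$. Two such polyhedra $P_1,P_2$ are called isomorphic if there is $\rho\in \mathrm{GL}(d,\mathbb{Z})$ with $\rho(P_1)=P_2$. Then there exist only finitely many $d$-dimensional Fano polyhedra up to isomorphism. -/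

import Mathlib

/-- A convex polyhedron with finitely many vertices, in the sense of a polytope:
the convex hull of a finite set of points of `ℝ^d`. -/
def IsConvexPolytope {d : ℕ} (P : Set (Fin d → ℝ)) : Prop :=
  ∃ V : Set (Fin d → ℝ), V.Finite ∧ P = convexHull ℝ V

/-- The vertices of a polytope (or of one of its faces) are its extreme points. -/
def polytopeVertices {d : ℕ} (P : Set (Fin d → ℝ)) : Set (Fin d → ℝ) :=
  P.extremePoints ℝ

/-- A proper face of a polytope `P`: a nonempty subset, different from `P`, on which some linear
functional attains its maximum over `P`. -/
def IsProperFace {d : ℕ} (P F : Set (Fin d → ℝ)) : Prop :=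
  F.Nonempty ∧ F ≠ P ∧ IsExposed ℝ P F

/-- A facet of a polytope in `ℝ^d`: a proper face of dimension `d - 1`. -/
def IsFacet {d : ℕ} (P F : Set (Fin d → ℝ)) : Prop :=
  IsProperFace P F ∧ Module.finrank ℝ (vectorSpan ℝ F) + 1 = d

/-- `F` is a (full, closed) simplex of some dimension. -/
def IsGeometricSimplex {d : ℕ} (F : Set (Fin d → ℝ)) : Prop :=
  ∃ (n : ℕ) (S : Affine.Simplex ℝ (Fin d → ℝ) n), F = convexHull ℝ (Set.range S.points)

/-- A lattice vector of `ℤ^d`, viewed as a point of `ℝ^d`. -/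
def latticePoint {d : ℕ} (z : Fin d → ℤ) : Fin d → ℝ :=
  fun i => (z i : ℝ)

/-- A `d`-dimensional Fano polyhedron in `ℝ^d`. It is of full dimension `d` because it contains
the origin in its interior. -/
structure IsFanoPolyhedron {d : ℕ} (P : Set (Fin d → ℝ)) : Prop where
  polytope : IsConvexPolytope P
  vertices_integral : ∀ v ∈ polytopeVertices P, ∃ z : Fin d → ℤ, v = latticePoint z
  zero_mem_interior : (0 : Fin d → ℝ) ∈ interior P
  simplicial : ∀ F : Set (Fin d → ℝ), IsProperFace P F → IsGeometricSimplex F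
  facet_basis : ∀ F : Set (Fin d → ℝ), IsFacet P F →
    ∃ b : Module.Basis (Fin d) ℤ (Fin d → ℤ),
      polytopeVertices F = Set.range (fun i => latticePoint (b i))

/-- The linear action of a unimodular integral matrix on `ℝ^d`. -/
def unimodularMap {d : ℕ} (A : Matrix.GeneralLinearGroup (Fin d) ℤ) (x : Fin d → ℝ) :
    Fin d → ℝ :=
  ((A : Matrix (Fin d) (Fin d) ℤ).map (fun a : ℤ => (a : ℝ))).mulVec x

/-- Isomorphism of Fano polyhedra: some element of `GL(d, ℤ)` maps the first onto the second. -/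
def FanoIsomorphic {d : ℕ} (P Q : Set (Fin d → ℝ)) : Prop :=
  ∃ A : Matrix.GeneralLinearGroup (Fin d) ℤ, unimodularMap A '' P = Q

/-! Some facet sees all vertices at bounded depth. Let `s` be the sum of the vertices; some extreme
point `φ` of the polar dual has `φ s ≥ 0`, and its contact set is a facet. Since `φ` is integral on
lattice points, at most `d` vertices have value `1` and the rest have value `≤ 0`, so every vertex
has `φ ≥ -d` (`exists_special_facet`). Pivoting to adjacent facets turns this depth bound into a
lower bound on each coordinate in the facet basis (`realCoord_ge`). The coordinates sum to `φ ≤ 1`,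
so they are bounded above too. Hence a unimodular change of basis puts all vertices into a fixed
lattice cube, which has finitely many subsets. -/

open Module Submodule

/-! ### Polar dual and facets -/

/-- The functionals bounded above by `1` on `P`. -/
def polarDual {d : ℕ} (P : Set (Fin d → ℝ)) : Set (StrongDual ℝ (Fin d → ℝ)) :=
  {φ | ∀ x ∈ P, φ x ≤ 1}

/-- A ball around `0` inside `P` bounds the norm of every polar functional. Compactness supplies the
extreme points used below. -/
theorem isCompact_polarDual {d : ℕ} {P : Set (Fin d → ℝ)} (h0 : (0 : Fin d → ℝ) ∈ interior P) :
    IsCompact (polarDual P) := by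
  obtain ⟨r, hr, hball⟩ := Metric.mem_nhds_iff.1 (mem_interior_iff_mem_nhds.1 h0)
  refine Metric.isCompact_of_isClosed_isBounded ?_ ?_
  · have : polarDual P = ⋂ x ∈ P, {φ : StrongDual ℝ (Fin d → ℝ) | φ x ≤ 1} := by
      ext φ; simp [polarDual]
    rw [this]
    refine isClosed_biInter fun x _ => isClosed_le (by fun_prop) continuous_const
  · refine (Metric.isBounded_iff_subset_closedBall 0).2 ⟨2 / r, fun φ hφ => ?_⟩
    rw [mem_closedBall_zero_iff]
    have key : ∀ x : Fin d → ℝ, φ x ≤ 2 / r * ‖x‖ := by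
      intro x
      rcases eq_or_ne x 0 with rfl | hx
      · simp
      have hx' : 0 < ‖x‖ := norm_pos_iff.2 hx
      have hmem : (r / 2 / ‖x‖) • x ∈ P := by
        apply hball
        rw [mem_ball_zero_iff, norm_smul, Real.norm_of_nonneg (by positivity),
          div_mul_cancel₀ _ hx'.ne']
        linarith
      have h1 := hφ _ hmem
      rw [map_smul, smul_eq_mul] at h1
      have h2 : φ x = (2 / r * ‖x‖) * (r / 2 / ‖x‖ * φ x) := by field_simp
      rw [h2]
      exact mul_le_of_le_one_right (by positivity) h1
    refine φ.opNorm_le_bound (by positivity) fun x => ?_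
    rw [Real.norm_eq_abs, abs_le]
    have := key (-x)
    rw [map_neg, norm_neg] at this
    exact ⟨by linarith, key x⟩

theorem IsConvexPolytope.finite_vertices {d : ℕ} {P : Set (Fin d → ℝ)} (h : IsConvexPolytope P) :
    (polytopeVertices P).Finite := by
  obtain ⟨V, hV, rfl⟩ := h
  exact hV.subset extremePoints_convexHull_subset

/-- A polytope is the convex hull of its vertices. -/
theorem IsConvexPolytope.convexHull_vertices {d : ℕ} {P : Set (Fin d → ℝ)}
    (h : IsConvexPolytope P) : convexHull ℝ (polytopeVertices P) = P := by
  have hfin := h.finite_vertices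
  obtain ⟨V, hV, rfl⟩ := h
  have := closure_convexHull_extremePoints (s := convexHull ℝ V) (hV.isCompact_convexHull ℝ)
    (convex_convexHull ℝ V)
  exact (hfin.isClosed_convexHull ℝ).closure_eq.symm.trans this

theorem IsConvexPolytope.le_of_vertices {d : ℕ} {P : Set (Fin d → ℝ)} (h : IsConvexPolytope P)
    (φ : StrongDual ℝ (Fin d → ℝ)) {c : ℝ} (hφ : ∀ v ∈ polytopeVertices P, φ v ≤ c) :
    ∀ x ∈ P, φ x ≤ c := by
  intro x hx
  rw [← h.convexHull_vertices] at hx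
  exact convexHull_min (t := {x | φ x ≤ c}) hφ
    (convex_halfSpace_le φ.toLinearMap.isLinear c) hx

/-- At an extreme point of the polar, the vertices on which the functional is `1` span. -/
theorem span_tight_of_mem_extremePoints {d : ℕ} {P : Set (Fin d → ℝ)} (h : IsConvexPolytope P)
    {φ : StrongDual ℝ (Fin d → ℝ)} (hφ : φ ∈ (polarDual P).extremePoints ℝ) :
    span ℝ {x ∈ P | φ x = 1} = ⊤ := by
  by_contra hne
  obtain ⟨f, hf0, hf⟩ := Submodule.exists_le_ker_of_lt_top _ (lt_top_iff_ne_top.2 hne)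
  set ψ : StrongDual ℝ (Fin d → ℝ) := f.toContinuousLinearMap with hψ
  have hψ0 : ψ ≠ 0 := by
    intro h0
    apply hf0
    ext x
    simpa [hψ] using DFunLike.congr_fun h0 (Pi.single x 1)
  have hle := hφ.1
  -- `ψ` vanishes at tight vertices and slack ones tolerate small perturbations, so `φ` is the
  -- midpoint of a segment in the polar.
  have hev : ∀ v ∈ polytopeVertices P, ∀ᶠ ε : ℝ in nhds 0, (φ + ε • ψ) v ≤ 1 := by
    intro v hv
    rcases (hle v hv.1).lt_or_eq with hlt | heq
    · have hc : Continuous fun ε : ℝ => (φ + ε • ψ) v := by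
        simp only [_root_.add_apply, _root_.smul_apply]
        fun_prop
      have : (fun ε : ℝ => (φ + ε • ψ) v) 0 < 1 := by simpa using hlt
      exact (hc.continuousAt.eventually_lt continuousAt_const this).mono fun _ h => h.le
    · refine Filter.Eventually.of_forall fun ε => ?_
      have : ψ v = 0 := hf (subset_span ⟨hv.1, heq⟩)
      simp [this, heq]
  have hall := (h.finite_vertices.eventually_all).2 hev
  obtain ⟨r, hr, hball⟩ := Metric.eventually_nhds_iff.1 hall
  have hmem : ∀ ε : ℝ, |ε| < r → φ + ε • ψ ∈ polarDual P := fun ε hε =>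
    h.le_of_vertices _ fun v hv => hball (by simpa using hε) v hv
  have h1 := hmem (r / 2) (by rw [abs_of_pos (by positivity)]; linarith)
  have h2 := hmem (-(r / 2)) (by rw [abs_neg, abs_of_pos (by positivity)]; linarith)
  have := hφ.2 h1 h2 ⟨1 / 2, 1 / 2, by norm_num, by norm_num, by norm_num, by module⟩
  rw [add_eq_left, smul_eq_zero] at this
  rcases this with h | h
  · linarith
  · exact hψ0 h

/-- Some extreme point of the polar is nonnegative at a given point. -/
theorem exists_extreme_polarDual_nonneg {d : ℕ} {P : Set (Fin d → ℝ)}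
    (h0 : (0 : Fin d → ℝ) ∈ interior P) (s : Fin d → ℝ) :
    ∃ φ ∈ (polarDual P).extremePoints ℝ, 0 ≤ φ s := by
  have hc := isCompact_polarDual h0
  have hz : (0 : StrongDual ℝ (Fin d → ℝ)) ∈ polarDual P := fun x _ => by simp
  let l : StrongDual ℝ (StrongDual ℝ (Fin d → ℝ)) := ContinuousLinearMap.apply ℝ ℝ s
  obtain ⟨m, hm, hmax⟩ := hc.exists_isMaxOn ⟨0, hz⟩ l.continuous.continuousOn
  have hexp : IsExposed ℝ (polarDual P) (l.toExposed (polarDual P)) :=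
    ContinuousLinearMap.toExposed.isExposed
  obtain ⟨φ, hφ⟩ := (hexp.isCompact hc).extremePoints_nonempty ⟨m, hm, hmax⟩
  refine ⟨φ, hexp.isExtreme.extremePoints_subset_extremePoints hφ, ?_⟩
  simpa [l] using hφ.1.2 0 hz

/-- A supporting functional whose contact set spans cuts out a facet. -/
theorem isFacet_of_span_tight {d : ℕ} (hd : 0 < d) {P : Set (Fin d → ℝ)} (h0 : 0 ∈ P)
    {φ : StrongDual ℝ (Fin d → ℝ)} (hφ : φ ∈ polarDual P)
    (hs : span ℝ {x ∈ P | φ x = 1} = ⊤) : IsFacet P {x ∈ P | φ x = 1} := by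
  have : Nonempty (Fin d) := ⟨⟨0, hd⟩⟩
  set F : Set (Fin d → ℝ) := {x ∈ P | φ x = 1} with hF
  have hne : F.Nonempty := by
    by_contra hcon
    rw [Set.not_nonempty_iff_eq_empty] at hcon
    rw [hcon, span_empty] at hs
    exact bot_ne_top hs
  obtain ⟨p, hp⟩ := hne
  refine ⟨⟨⟨p, hp⟩, ?_, ?_⟩, ?_⟩
  · intro heq
    have : (0 : Fin d → ℝ) ∈ F := heq ▸ h0
    simpa using this.2
  · intro _
    refine ⟨φ, Set.ext fun x => ⟨fun hx => ⟨hx.1, fun y hy => hx.2 ▸ hφ y hy⟩, fun hx =>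
      ⟨hx.1, le_antisymm (hφ x hx.1) (hp.2 ▸ hx.2 p hp.1)⟩⟩⟩
  · have hker : vectorSpan ℝ F ≤ LinearMap.ker (φ : (Fin d → ℝ) →ₗ[ℝ] ℝ) := by
      rw [vectorSpan_def, span_le]
      rintro _ ⟨x, hx, y, hy, rfl⟩
      simp [hx.2, hy.2]
    have hsurj : Function.Surjective (φ : (Fin d → ℝ) →ₗ[ℝ] ℝ) := by
      intro c
      exact ⟨c • p, by simp [hp.2]⟩
    have hk := LinearMap.finrank_range_add_finrank_ker (φ : (Fin d → ℝ) →ₗ[ℝ] ℝ)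
    rw [LinearMap.range_eq_top.2 hsurj, finrank_top, finrank_self, finrank_fin_fun] at hk
    have hle := Submodule.finrank_mono hker
    -- One extra vector `p` completes `vectorSpan ℝ F` to the whole space, so its dimension is at
    -- least `d - 1`; the kernel of `φ` gives the reverse bound.
    have hsup : vectorSpan ℝ F ⊔ span ℝ {p} = ⊤ := by
      rw [eq_top_iff, ← hs, span_le]
      intro x hx
      have : x = (x -ᵥ p) + p := by simp
      rw [this]
      exact add_mem_sup (vsub_mem_vectorSpan ℝ hx hp) (mem_span_singleton_self p)
    have h1 := Submodule.finrank_add_le_finrank_add_finrank (vectorSpan ℝ F) (span ℝ {p})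
    rw [hsup, finrank_top, finrank_fin_fun] at h1
    have h2 : finrank ℝ (span ℝ {p}) ≤ 1 := by
      simpa using finrank_span_le_card (R := ℝ) ({p} : Set (Fin d → ℝ))
    omega

/-! ### Coordinates in a lattice basis -/

/-- The change of coordinates to an integral basis. -/
noncomputable def coordGL {d : ℕ} (b : Basis (Fin d) ℤ (Fin d → ℤ)) : Matrix.GeneralLinearGroup (Fin d) ℤ :=
  ⟨b.toMatrix (Pi.basisFun ℤ (Fin d)), (Pi.basisFun ℤ (Fin d)).toMatrix b,
    Basis.toMatrix_mul_toMatrix_flip _ _, Basis.toMatrix_mul_toMatrix_flip _ _⟩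

theorem unimodularMap_mul {d : ℕ} (A B : Matrix.GeneralLinearGroup (Fin d) ℤ) (x : Fin d → ℝ) :
    unimodularMap (A * B) x = unimodularMap A (unimodularMap B x) := by
  have : ((A * B : Matrix.GeneralLinearGroup (Fin d) ℤ) : Matrix (Fin d) (Fin d) ℤ).map
      (fun a : ℤ => (a : ℝ)) = (A : Matrix (Fin d) (Fin d) ℤ).map (fun a : ℤ => (a : ℝ)) *
        (B : Matrix (Fin d) (Fin d) ℤ).map (fun a : ℤ => (a : ℝ)) := by
    ext i j
    simp [Matrix.mul_apply]
  simp only [unimodularMap, this, Matrix.mulVec_mulVec]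

theorem unimodularMap_one {d : ℕ} (x : Fin d → ℝ) :
    unimodularMap (1 : Matrix.GeneralLinearGroup (Fin d) ℤ) x = x := by
  have : ((1 : Matrix.GeneralLinearGroup (Fin d) ℤ) : Matrix (Fin d) (Fin d) ℤ).map
      (fun a : ℤ => (a : ℝ)) = 1 := by
    ext i j
    simp [Matrix.one_apply]
  simp only [unimodularMap, this, Matrix.one_mulVec]

theorem unimodularMap_latticePoint {d : ℕ} (A : Matrix.GeneralLinearGroup (Fin d) ℤ)
    (z : Fin d → ℤ) :
    unimodularMap A (latticePoint z) =
      latticePoint ((A : Matrix (Fin d) (Fin d) ℤ).mulVec z) := by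
  ext i
  simp [unimodularMap, latticePoint, Matrix.mulVec, dotProduct]

/-- `unimodularMap` as a linear map. -/
def unimodularLin {d : ℕ} (A : Matrix.GeneralLinearGroup (Fin d) ℤ) :
    (Fin d → ℝ) →ₗ[ℝ] (Fin d → ℝ) :=
  Matrix.mulVecLin ((A : Matrix (Fin d) (Fin d) ℤ).map (fun a : ℤ => (a : ℝ)))

theorem coe_unimodularLin {d : ℕ} (A : Matrix.GeneralLinearGroup (Fin d) ℤ) :
    ⇑(unimodularLin A) = unimodularMap A := rfl

/-- The real coordinates of a vector in an integral basis. -/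
noncomputable def realCoord {d : ℕ} (b : Basis (Fin d) ℤ (Fin d → ℤ)) (i : Fin d) :
    StrongDual ℝ (Fin d → ℝ) :=
  ((LinearMap.proj i).comp (unimodularLin (coordGL b))).toContinuousLinearMap

theorem realCoord_apply {d : ℕ} (b : Basis (Fin d) ℤ (Fin d → ℤ)) (i : Fin d)
    (x : Fin d → ℝ) : realCoord b i x = unimodularMap (coordGL b) x i := rfl

theorem realCoord_latticePoint {d : ℕ} (b : Basis (Fin d) ℤ (Fin d → ℤ)) (i : Fin d)
    (z : Fin d → ℤ) : realCoord b i (latticePoint z) = (b.repr z i : ℝ) := by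
  have : (b.toMatrix (Pi.basisFun ℤ (Fin d))).mulVec z = b.repr z :=
    Basis.toMatrix_mulVec_repr (Pi.basisFun ℤ (Fin d)) b z
  rw [realCoord_apply, unimodularMap_latticePoint]
  simp only [coordGL, this, latticePoint]

theorem realCoord_basis {d : ℕ} (b : Basis (Fin d) ℤ (Fin d → ℤ)) (i j : Fin d) :
    realCoord b i (latticePoint (b j)) = if j = i then 1 else 0 := by
  rw [realCoord_latticePoint, Basis.repr_self, Finsupp.single_apply]
  split_ifs <;> simp

theorem sum_realCoord_smul {d : ℕ} (b : Basis (Fin d) ℤ (Fin d → ℤ)) (x : Fin d → ℝ) :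
    ∑ i, realCoord b i x • latticePoint (b i) = x := by
  have h : unimodularMap (coordGL b)⁻¹ (unimodularMap (coordGL b) x) = x := by
    rw [← unimodularMap_mul, inv_mul_cancel, unimodularMap_one]
  conv_rhs => rw [← h]
  ext k
  simp only [Finset.sum_apply, Pi.smul_apply, smul_eq_mul, realCoord_apply]
  change _ = (((Pi.basisFun ℤ (Fin d)).toMatrix b).map (fun a : ℤ => (a : ℝ))).mulVec _ k
  simp [Matrix.mulVec, dotProduct, latticePoint, Basis.toMatrix_apply, mul_comm]

/-! ### Facet bases and pivoting -/

/-- A facet of a Fano polyhedron given by its supporting functional `φ` and the basis `b` formed by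
its vertices. -/
structure IsFacetPair {d : ℕ} (P : Set (Fin d → ℝ)) (φ : StrongDual ℝ (Fin d → ℝ))
    (b : Basis (Fin d) ℤ (Fin d → ℤ)) : Prop where
  mem_polar : φ ∈ polarDual P
  apply_basis : ∀ i, φ (latticePoint (b i)) = 1
  basis_mem : ∀ i, latticePoint (b i) ∈ polytopeVertices P
  eq_basis : ∀ v ∈ polytopeVertices P, φ v = 1 → ∃ i, v = latticePoint (b i)

theorem IsFanoPolyhedron.exists_isFacetPair {d : ℕ} (hd : 0 < d) {P : Set (Fin d → ℝ)}
    (hP : IsFanoPolyhedron P) {φ : StrongDual ℝ (Fin d → ℝ)} (hφ : φ ∈ polarDual P)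
    (hs : span ℝ {x ∈ P | φ x = 1} = ⊤) : ∃ b, IsFacetPair P φ b := by
  have hfacet := isFacet_of_span_tight hd (interior_subset hP.zero_mem_interior) hφ hs
  obtain ⟨b, hb⟩ := hP.facet_basis _ hfacet
  have hmem : ∀ i, latticePoint (b i) ∈ polytopeVertices {x ∈ P | φ x = 1} := fun i => by
    rw [hb]; exact ⟨i, rfl⟩
  refine ⟨b, hφ, fun i => (hmem i).1.2, fun i =>
    hfacet.1.2.2.isExtreme.extremePoints_subset_extremePoints (hmem i), fun v hv hv1 => ?_⟩
  have : v ∈ polytopeVertices {x ∈ P | φ x = 1} :=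
    inter_extremePoints_subset_extremePoints_of_subset (fun x hx => hx.1) ⟨⟨hv.1, hv1⟩, hv⟩
  rw [hb] at this
  obtain ⟨i, rfl⟩ := this
  exact ⟨i, rfl⟩

theorem IsFacetPair.eq_sum {d : ℕ} {P : Set (Fin d → ℝ)} {φ : StrongDual ℝ (Fin d → ℝ)}
    {b : Basis (Fin d) ℤ (Fin d → ℤ)} (h : IsFacetPair P φ b) (x : Fin d → ℝ) :
    φ x = ∑ i, realCoord b i x := by
  conv_lhs => rw [← sum_realCoord_smul b x]
  simp [h.apply_basis]

theorem IsFacetPair.integral {d : ℕ} {P : Set (Fin d → ℝ)} {φ : StrongDual ℝ (Fin d → ℝ)}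
    {b : Basis (Fin d) ℤ (Fin d → ℤ)} (h : IsFacetPair P φ b) (z : Fin d → ℤ) :
    ∃ n : ℤ, φ (latticePoint z) = n :=
  ⟨∑ i, b.repr z i, by simp [h.eq_sum, realCoord_latticePoint]⟩

/-- Every nonzero functional is negative at some vertex. -/
theorem IsFanoPolyhedron.exists_vertex_neg {d : ℕ} {P : Set (Fin d → ℝ)}
    (hP : IsFanoPolyhedron P) {ψ : StrongDual ℝ (Fin d → ℝ)} {x : Fin d → ℝ} (hx : 0 < ψ x) :
    ∃ v ∈ polytopeVertices P, ψ v < 0 := by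
  by_contra! hcon
  have hall : ∀ y ∈ P, (-ψ) y ≤ 0 := hP.polytope.le_of_vertices _ fun v hv => by
    simpa using hcon v hv
  have hc : Filter.Tendsto (fun ε : ℝ => (-ε) • x) (nhds 0) (nhds 0) := by
    have : Continuous fun ε : ℝ => (-ε) • x := by fun_prop
    simpa using this.tendsto 0
  have hev := hc.eventually (mem_interior_iff_mem_nhds.1 hP.zero_mem_interior)
  obtain ⟨r, hr, hball⟩ := Metric.eventually_nhds_iff.1 hev
  have hm : (-(r / 2)) • x ∈ P := hball (y := r / 2) (by
    rw [Real.dist_eq, sub_zero, abs_of_pos (by positivity)]; linarith)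
  have h1 := hall _ hm
  simp only [_root_.neg_apply, map_smul, smul_eq_mul] at h1
  nlinarith [mul_pos hr hx]

/-- Pivoting to the adjacent facet bounds the coordinates of the vertices from below. -/
theorem IsFacetPair.realCoord_ge {d : ℕ} (hd : 0 < d) {P : Set (Fin d → ℝ)}
    (hP : IsFanoPolyhedron P) {φ : StrongDual ℝ (Fin d → ℝ)}
    {b : Basis (Fin d) ℤ (Fin d → ℤ)} (h : IsFacetPair P φ b) (i : Fin d) {v : Fin d → ℝ}
    (hv : v ∈ polytopeVertices P) : φ v - 1 ≤ realCoord b i v := by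
  classical
  set a := realCoord b i with ha
  have hai : a (latticePoint (b i)) = 1 := by simp [ha, realCoord_basis]
  have hfin : {v ∈ polytopeVertices P | a v < 0}.Finite :=
    hP.polytope.finite_vertices.subset fun x hx => hx.1
  obtain ⟨u, hu, hun⟩ := hP.exists_vertex_neg (ψ := a) (x := latticePoint (b i)) (by
    rw [hai]; exact one_pos)
  -- The minimal ratio is the largest `t` keeping `φ - t • a` in the polar; `w` is the vertex
  -- entering at the pivot.
  obtain ⟨w, ⟨hw, hwn⟩, hmin⟩ := Set.exists_min_image _ (fun v => (1 - φ v) / (-a v)) hfin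
    ⟨u, hu, hun⟩
  set t := (1 - φ w) / (-a w) with ht
  have hφw : φ w < 1 := by
    refine lt_of_le_of_ne (h.mem_polar w hw.1) fun heq => ?_
    obtain ⟨j, rfl⟩ := h.eq_basis w hw heq
    rw [ha, realCoord_basis] at hwn
    split_ifs at hwn <;> linarith
  have htpos : 0 < t := div_pos (by linarith) (by linarith)
  have htw : t * (-a w) = 1 - φ w := div_mul_cancel₀ _ (by linarith : (-a w) ≠ 0)
  have hkey : ∀ v ∈ polytopeVertices P, φ v - t * a v ≤ 1 := by
    intro v hv
    rcases lt_or_ge (a v) 0 with hneg | hpos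
    · have h1 := hmin v ⟨hv, hneg⟩
      change t ≤ _ at h1
      rw [le_div_iff₀ (by linarith)] at h1
      linarith
    · have := h.mem_polar v hv.1
      have := mul_nonneg htpos.le hpos
      linarith
  have hpol : φ - t • a ∈ polarDual P := hP.polytope.le_of_vertices _ fun v hv => by
    simpa using hkey v hv
  have hspan : span ℝ {x ∈ P | (φ - t • a) x = 1} = ⊤ := by
    set T := span ℝ {x ∈ P | (φ - t • a) x = 1} with hT
    have hj : ∀ j, j ≠ i → latticePoint (b j) ∈ T := fun j hji => subset_span
      ⟨(h.basis_mem j).1, by simp [ha, h.apply_basis, realCoord_basis, hji]⟩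
    have hwT : w ∈ T := subset_span ⟨hw.1, by
      simp only [_root_.sub_apply, _root_.smul_apply, smul_eq_mul]
      linarith⟩
    have hi : latticePoint (b i) ∈ T := by
      have hsum := sum_realCoord_smul b w
      rw [← Finset.add_sum_erase _ _ (Finset.mem_univ i)] at hsum
      have h1 : a w • latticePoint (b i) ∈ T := by
        rw [ha, eq_sub_of_add_eq hsum]
        exact sub_mem hwT (sum_mem fun j hj' => smul_mem _ _ (hj j (Finset.ne_of_mem_erase hj')))
      exact (Submodule.smul_mem_iff _ hwn.ne).1 h1
    rw [eq_top_iff]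
    intro x _
    rw [← sum_realCoord_smul b x]
    refine sum_mem fun j _ => smul_mem _ _ ?_
    by_cases hji : j = i
    · exact hji ▸ hi
    · exact hj j hji
  obtain ⟨b', hb'⟩ := hP.exists_isFacetPair hd hpol hspan
  -- The adjacent functional takes the integer value `1 - t` at `b i`; as `t > 0`, this forces `t ≥
  -- 1`.
  obtain ⟨n, hn⟩ := hb'.integral (b i)
  simp only [_root_.sub_apply, _root_.smul_apply, smul_eq_mul, hai,
    h.apply_basis] at hn
  have ht1 : 1 ≤ t := by
    have h1 : (n : ℝ) < 1 := by linarith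
    have h2 : n ≤ 0 := by
      have : n < 1 := by exact_mod_cast h1
      omega
    have h3 : (n : ℝ) ≤ 0 := by exact_mod_cast h2
    linarith
  rcases lt_or_ge (a v) 0 with hneg | hpos
  · have h1 := hkey v hv
    have hu1 := h.mem_polar v hv.1
    nlinarith [mul_le_mul_of_nonneg_right ht1 (sub_nonneg.2 hu1), hkey v hv]
  · have := h.mem_polar v hv.1
    linarith

/-- Some facet has all vertices at bounded depth below it. -/
theorem IsFanoPolyhedron.exists_special_facet {d : ℕ} (hd : 0 < d) {P : Set (Fin d → ℝ)}
    (hP : IsFanoPolyhedron P) :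
    ∃ φ b, IsFacetPair P φ b ∧ ∀ v ∈ polytopeVertices P, -(d : ℝ) ≤ φ v := by
  classical
  have hfin := hP.polytope.finite_vertices
  obtain ⟨φ, hφ, hnn⟩ := exists_extreme_polarDual_nonneg hP.zero_mem_interior
    (∑ v ∈ hfin.toFinset, v)
  obtain ⟨b, hb⟩ := hP.exists_isFacetPair hd hφ.1
    (span_tight_of_mem_extremePoints hP.polytope hφ)
  refine ⟨φ, b, hb, fun v hv => ?_⟩
  set T : Finset (Fin d → ℝ) := Finset.univ.image fun i => latticePoint (b i) with hT
  have hle : ∀ u ∈ polytopeVertices P, φ u ≤ if u ∈ T then 1 else 0 := by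
    intro u hu
    split_ifs with huT
    · exact hb.mem_polar u hu.1
    · have hlt : φ u < 1 := by
        refine lt_of_le_of_ne (hb.mem_polar u hu.1) fun heq => huT ?_
        obtain ⟨i, rfl⟩ := hb.eq_basis u hu heq
        exact Finset.mem_image_of_mem _ (Finset.mem_univ i)
      obtain ⟨z, rfl⟩ := hP.vertices_integral u hu
      obtain ⟨n, hn⟩ := hb.integral z
      rw [hn] at hlt ⊢
      have : n < 1 := by exact_mod_cast hlt
      exact_mod_cast (by omega : n ≤ 0)
  have hcard : (T.card : ℝ) ≤ d := by
    have : T.card ≤ d := by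
      simpa using Finset.card_image_le (s := Finset.univ) (f := fun i => latticePoint (b i))
    exact_mod_cast this
  rw [map_sum, ← Finset.add_sum_erase _ _ (hfin.mem_toFinset.2 hv)] at hnn
  have h1 : ∑ u ∈ hfin.toFinset.erase v, φ u ≤
      ∑ u ∈ hfin.toFinset.erase v, if u ∈ T then (1 : ℝ) else 0 :=
    Finset.sum_le_sum fun u hu => hle u (hfin.mem_toFinset.1 (Finset.mem_of_mem_erase hu))
  have h2 : ∑ u ∈ hfin.toFinset.erase v, (if u ∈ T then (1 : ℝ) else 0) ≤ T.card := by
    rw [← Finset.sum_filter, Finset.sum_const, nsmul_eq_mul, mul_one]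
    exact_mod_cast Finset.card_le_card fun u hu => (Finset.mem_filter.1 hu).2
  linarith

/-! ### Finiteness -/

/-- The lattice points of the cube `[-N, N]^d`. -/
def latticeCube (d N : ℕ) : Set (Fin d → ℝ) :=
  latticePoint '' Set.Icc (fun _ => -(N : ℤ)) (fun _ => (N : ℤ))

theorem finite_latticeCube (d N : ℕ) : (latticeCube d N).Finite :=
  (Set.finite_Icc _ _).image _

theorem IsFanoPolyhedron.exists_unimodularMap_image {d : ℕ} (hd : 0 < d) {P : Set (Fin d → ℝ)}
    (hP : IsFanoPolyhedron P) :
    ∃ W ⊆ latticeCube d (1 + d * (d + 1)), FanoIsomorphic P (convexHull ℝ W) := by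
  obtain ⟨φ, b, hb, hdepth⟩ := hP.exists_special_facet hd
  refine ⟨unimodularMap (coordGL b) '' polytopeVertices P, ?_, coordGL b, ?_⟩
  · rintro _ ⟨v, hv, rfl⟩
    obtain ⟨z, rfl⟩ := hP.vertices_integral v hv
    have hlow : ∀ i, -((d : ℝ) + 1) ≤ realCoord b i (latticePoint z) := fun i => by
      have h1 := hb.realCoord_ge hd hP i hv
      have h2 := hdepth _ hv
      linarith
    -- Shifted by `d + 1` the coordinates are nonnegative, so each is at most their sum `φ + d * (d
    -- + 1)`.
    have hup : ∀ i, realCoord b i (latticePoint z) ≤ 1 + d * (d + 1) := fun i => by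
      have h1 := hb.mem_polar _ hv.1
      rw [hb.eq_sum] at h1
      have h2 : realCoord b i (latticePoint z) + (d + 1) ≤
          ∑ j, (realCoord b j (latticePoint z) + (d + 1)) :=
        Finset.single_le_sum (f := fun j => realCoord b j (latticePoint z) + ((d : ℝ) + 1))
          (fun j _ => by linarith [hlow j]) (Finset.mem_univ i)
      rw [Finset.sum_add_distrib, Finset.sum_const, Finset.card_univ, Fintype.card_fin,
        nsmul_eq_mul] at h2
      have : (0 : ℝ) ≤ d := Nat.cast_nonneg d
      linarith
    rw [unimodularMap_latticePoint]
    refine ⟨_, ⟨fun i => ?_, fun i => ?_⟩, rfl⟩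
    all_goals
      have h1 := hlow i
      have h2 := hup i
      rw [realCoord_apply, unimodularMap_latticePoint] at h1 h2
      simp only [latticePoint] at h1 h2
    · have h3 : -((d : ℤ) + 1) ≤ ((coordGL b : Matrix (Fin d) (Fin d) ℤ).mulVec z) i := by
        exact_mod_cast h1
      have hd' : (1 : ℤ) ≤ d := by exact_mod_cast hd
      push_cast
      nlinarith
    · exact_mod_cast h2
  · rw [← coe_unimodularLin, ← LinearMap.image_convexHull, hP.polytope.convexHull_vertices]

theorem FanoIsomorphic.of_common {d : ℕ} {P P' Q : Set (Fin d → ℝ)} (h : FanoIsomorphic P Q)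
    (h' : FanoIsomorphic P' Q) : FanoIsomorphic P P' := by
  obtain ⟨A, rfl⟩ := h
  obtain ⟨B, hB⟩ := h'
  refine ⟨B⁻¹ * A, ?_⟩
  have h1 : unimodularMap (B⁻¹ * A) = unimodularMap B⁻¹ ∘ unimodularMap A :=
    funext (unimodularMap_mul _ _)
  rw [h1, Set.image_comp, ← hB, Set.image_image]
  simp [← unimodularMap_mul, unimodularMap_one]

theorem mainTheorem9 (d : ℕ) (hd : 0 < d) :
    ∃ S : Set (Set (Fin d → ℝ)), S.Finite ∧ (∀ Q ∈ S, IsFanoPolyhedron Q) ∧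
      ∀ P : Set (Fin d → ℝ), IsFanoPolyhedron P → ∃ Q ∈ S, FanoIsomorphic P Q := by
  let T : Set (Set (Fin d → ℝ)) := {W | W ⊆ latticeCube d (1 + d * (d + 1)) ∧
    ∃ P, IsFanoPolyhedron P ∧ FanoIsomorphic P (convexHull ℝ W)}
  have hT : T.Finite := (finite_latticeCube d _).finite_subsets.subset fun W hW => hW.1
  -- Choosing one Fano polyhedron per `W` avoids proving that the hull of `W` is itself Fano.
  have hrep : ∀ W : T, ∃ P, IsFanoPolyhedron P ∧ FanoIsomorphic P (convexHull ℝ W.1) :=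
    fun W => W.2.2
  choose f hf using hrep
  have := hT.to_subtype
  refine ⟨Set.range f, Set.finite_range f, ?_, fun P hP => ?_⟩
  · rintro _ ⟨W, rfl⟩
    exact (hf W).1
  · obtain ⟨W, hW, hPW⟩ := hP.exists_unimodularMap_image hd
    exact ⟨_, ⟨⟨W, hW, P, hP, hPW⟩, rfl⟩, hPW.of_common (hf _).2⟩
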